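/- Let $p$ be a prime with $p\equiv 3\pmod 4$, let $n=2p$, and let $q$ be a prime power with $q\equiv 3\pmod 4$, $\gcd(p,q)=1$ and $\mathrm{ord}_{4p}(q)=p-1$. Assume that the order of $q$ modulo $p$ is $\equiv 2\pmod 4$. Then $x^n+1=(x^2+1)\,g_1(x)\,g_2(x)$ over $\mathbb{F}_q$, where $x^2+1,g_1,g_2$ are irreducible, $g_1,g_2$ are monic of degree $p-1$, and $g_1,g_2$ are self-reciprocal, i.e. $g_j(x)=x^{p-1}g_j(1/x)$. Let $R=\mathbb{F}_q[x]/(x^n+1)$ and, for $a\in R$, let $a'(x)=a(-x^{n-1})$ in $R$. A negacirculant matrix is an $n\times n$ matrix each of whose rows is obtained from the previous one by the negashift $(x_0,\dots,x_{n-1})\mapsto(-x_{n-1},x_0,\dots,x_{n-2})$; it is attached to the element of $R$ whose coefficient vector is its first row. Coefficient vectors identify $\mathbb{F}_q^{\ell n}$ with $R^{\ell}$. A code is self-dual if it equals its dual for the standard inner product $\sum_i u_iv_i$. 1. The number of self-dual double-negacirculant codes of length $2n$ over $\mathbb{F}_q$, i.e. self-dual codes with generator matrix $(I_n\ H)$,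 $H$ the negacirculant matrix attached to some $h\in R$, which as $R$-submodules of $R^2$ are $\langle(1,h)\rangle$, is $$(q+1)\left(q^{\frac{p-1}{2}}+1\right)^2 .$$ 2. The number of self-dual four-negacirculant codes of length $4n$ over $\mathbb{F}_q$, i.e. self-dual codes with generator matrix $\begin{pmatrix} I_n&0&A&B\\0&I_n&-B^t&A^t\end{pmatrix}$, $A,B$ the negacirculant matrices attached to some $a,b\in R$, which as $R$-submodules of $R^4$ are $\langle(1,0,a,b),(0,1,-b',a')\rangle$, is $$(q+1)(q^2-q)\left(q^{\frac{p-1}{2}}+1\right)^2\left(q^{p-1}-q^{\frac{p-1}{2}}\right)^2 .$$ -/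

import Mathlib

open Polynomial

/-- The `n × n` negacirculant matrix with first row `a`: every row is the negashift
`(x₀, …, xₙ₋₁) ↦ (-xₙ₋₁, x₀, …, xₙ₋₂)` of the previous one.
The subtraction `j - i` is modulo `n`. -/
def negacirculant {F : Type*} [Field F] {n : ℕ} (a : Fin n → F) : Matrix (Fin n) (Fin n) F :=
  Matrix.of fun i j => if i ≤ j then a (j - i) else -a (j - i)

/-- The linear code spanned by the rows of a generator matrix. -/
def rowCode {F : Type*} [Field F] {ι κ : Type*} (G : Matrix ι κ F) : Submodule F (κ → F) :=
  Submodule.span F (Set.range G.row)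

/-- A code is self-dual if it equals its dual for the standard inner product `∑ uᵢ vᵢ`. -/
def IsSelfDual {F : Type*} [Field F] {κ : Type*} [Fintype κ] (C : Submodule F (κ → F)) : Prop :=
  ∀ v : κ → F, v ∈ C ↔ ∀ c ∈ C, v ⬝ᵥ c = 0

/-- The code of length `2n` with generator matrix `(I H)`, where `H` is negacirculant
with first row `h`. -/
def doubleNegacirculantCode {F : Type*} [Field F] {n : ℕ} (h : Fin n → F) :
    Submodule F (Fin 2 × Fin n → F) :=
  rowCode (Matrix.comp (Fin 1) (Fin 2) (Fin n) (Fin n) F !![1, negacirculant h])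

/-- The code of length `4n` with generator matrix `(I 0 A B; 0 I -Bᵗ Aᵗ)`, where `A`, `B` are
negacirculant with first rows `a`, `b`. -/
def fourNegacirculantCode {F : Type*} [Field F] {n : ℕ} (a b : Fin n → F) :
    Submodule F (Fin 4 × Fin n → F) :=
  rowCode (Matrix.comp (Fin 2) (Fin 4) (Fin n) (Fin n) F
    !![1, 0, negacirculant a, negacirculant b;
       0, 1, -(negacirculant b).transpose, (negacirculant a).transpose])

/-- The ring `F[x]/(xⁿ + 1)`. -/
abbrev NegaRing (F : Type*) [Field F] (n : ℕ) : Type _ :=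
  AdjoinRoot (X ^ n + 1 : F[X])

/-- The class of `x` in `F[x]/(xⁿ + 1)`. -/
noncomputable abbrev NegaRing.x (F : Type*) [Field F] (n : ℕ) : NegaRing F n :=
  AdjoinRoot.root (X ^ n + 1 : F[X])

/-- The polynomial `a₀ + a₁ x + ⋯ + aₙ₋₁ xⁿ⁻¹`. -/
noncomputable def vecPoly {F : Type*} [Field F] {n : ℕ} (a : Fin n → F) : F[X] :=
  ∑ i : Fin n, C (a i) * X ^ (i : ℕ)

/-- The element `a(x)` of `F[x]/(xⁿ + 1)` whose `x`-expansion is `a`. -/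
noncomputable def toNegaRing {F : Type*} [Field F] {n : ℕ} (a : Fin n → F) : NegaRing F n :=
  aeval (NegaRing.x F n) (vecPoly a)

/-- The element `a'(x) = a(-xⁿ⁻¹)` of `F[x]/(xⁿ + 1)`. -/
noncomputable def toNegaRingPrime {F : Type*} [Field F] {n : ℕ} (a : Fin n → F) : NegaRing F n :=
  aeval (-(NegaRing.x F n) ^ (n - 1)) (vecPoly a)

/-- Identify `F^(ℓn)` with `(F[x]/(xⁿ + 1))^ℓ` blockwise through `x`-expansions. The code `C` is
generated by `S` if it corresponds to the `F[x]/(xⁿ + 1)`-submodule spanned by `S`. -/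
def IsGeneratedBy {F : Type*} [Field F] {n l : ℕ} (C : Submodule F (Fin l × Fin n → F))
    (S : Set (Fin l → NegaRing F n)) : Prop :=
  ∀ v : Fin l × Fin n → F,
    v ∈ C ↔ (fun j => toNegaRing fun i => v (j, i)) ∈ Submodule.span (NegaRing F n) S

/-! Let `R = F[x]/(xⁿ + 1)` with the involution `conj` sending `x` to `x⁻¹`. The powers of `x` are
orthonormal for `trace (r * conj s)`, so the standard inner product is the trace of a Hermitian form
on `Rˡ`. Hence the two kinds of codes are self-dual exactly when `h h' = -1`, respectively `a a' + b
b' = -1` (`isSelfDual_doubleNegacirculantCode_iff`, `isSelfDual_fourNegacirculantCode_iff`), and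
distinct solutions give distinct codes.

To count solutions, split `R` by the Chinese remainder theorem (`adjoinRoot_prod_bijective`) into
fields of sizes `q²`, `q^(p-1)`, `q^(p-1)`. Since `4p ∣ q^((p-1)/2) + 1`, a power of Frobenius
inverts the root in each field, so conjugation there is `y ↦ y ^ Q` with `Q²` the size of the field
(`algHomOfDvd_conj`). The equations become norm equations, counted by `card_norm_eq` and
`card_sum_two_norms_eq`. The same inversion of roots makes `g₁`, `g₂` self-reciprocal. -/

/-! ### Norm equations over finite fields. -/

/-- In a finite field with `Q²` elements, every nonzero element fixed by `y ↦ y ^ Q` is the norm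
of exactly `Q + 1` elements. -/
theorem card_norm_eq {K : Type*} [Field K] [Finite K] {Q : ℕ} (hK : Nat.card K = Q ^ 2)
    {c : K} (hc0 : c ≠ 0) (hc : c ^ Q = c) :
    Nat.card {y : K // y * y ^ Q = c} = Q + 1 := by
  have hQ : 2 ≤ Q := by
    have := Finite.one_lt_card (α := K)
    by_contra! h
    interval_cases Q <;> simp_all
  have hU : Nat.card Kˣ = (Q + 1) * (Q - 1) := by
    rw [Nat.card_units, hK, ← Nat.sq_sub_sq, one_pow]
  have hker : Nat.card (powMonoidHom (Q + 1) : Kˣ →* Kˣ).ker = Q + 1 := by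
    rw [IsCyclic.card_powMonoidHom_ker, hU]; simp
  -- The unit group is cyclic of order `(Q + 1)(Q - 1)`, so both subgroups have order `Q - 1`; hence
  -- every nonzero fixed element is a norm.
  have hrange : (powMonoidHom (Q + 1) : Kˣ →* Kˣ).range = (powMonoidHom (Q - 1)).ker := by
    apply Subgroup.eq_of_le_of_card_ge
    · rintro _ ⟨u, rfl⟩
      simp only [MonoidHom.mem_ker, powMonoidHom_apply, ← pow_mul]
      rw [← hU, pow_card_eq_one']
    · rw [IsCyclic.card_powMonoidHom_ker, IsCyclic.card_powMonoidHom_range, hU]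
      simp
  have hmem : Units.mk0 c hc0 ∈ (powMonoidHom (Q + 1) : Kˣ →* Kˣ).range := by
    rw [hrange, MonoidHom.mem_ker, powMonoidHom_apply, Units.ext_iff]
    simp only [Units.val_pow_eq_pow_val, Units.val_mk0, Units.val_one]
    apply mul_left_cancel₀ hc0
    rw [← pow_succ', Nat.sub_add_cancel (by omega), hc, mul_one]
  obtain ⟨u, hu⟩ := hmem
  have hu' : (u : K) ^ (Q + 1) = c := by simpa [Units.ext_iff] using hu
  rw [← hker]
  -- The solutions form the coset of the kernel through the particular solution `u`.
  refine Nat.card_congr ⟨fun y => ⟨Units.mk0 y.1 ?_ * u⁻¹, ?_⟩, fun v => ⟨(v.1 * u : Kˣ), ?_⟩, ?_, ?_⟩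
  · intro h
    have := y.2
    rw [h, zero_mul] at this
    exact hc0 this.symm
  · rw [MonoidHom.mem_ker, powMonoidHom_apply, Units.ext_iff]
    have := y.2
    simp only [Units.val_pow_eq_pow_val, Units.val_mul, Units.val_mk0, Units.val_one, mul_pow,
      Units.val_inv_eq_inv_val, inv_pow, hu', pow_succ' y.1]
    rw [this, mul_inv_cancel₀ hc0]
  · have := v.2
    rw [MonoidHom.mem_ker, powMonoidHom_apply, Units.ext_iff] at this
    simp only [Units.val_pow_eq_pow_val, Units.val_one] at this
    rw [← pow_succ', Units.val_mul, mul_pow, this, hu', one_mul]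
  · intro y; ext; simp
  · intro v; ext; simp

/-- Fix the first coordinate `a`. If its norm is `c`, only `b = 0` completes it; otherwise `c` minus
that norm is a nonzero fixed element, with `Q + 1` preimages. The total is `(Q + 1) + (Q² - Q - 1)(Q
+ 1)`. -/
theorem card_sum_two_norms_eq {K : Type*} [Field K] [Finite K] {Q : ℕ} (hK : Nat.card K = Q ^ 2)
    (σ : K →+* K) (hσ : ∀ y, σ y = y ^ Q) {c : K} (hc0 : c ≠ 0) (hc : c ^ Q = c) :
    Nat.card {y : K × K // y.1 * y.1 ^ Q + y.2 * y.2 ^ Q = c} = (Q + 1) * (Q ^ 2 - Q) := by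
  classical
  have := Fintype.ofFinite K
  have hQ : 2 ≤ Q := by
    have := Finite.one_lt_card (α := K)
    by_contra! h
    interval_cases Q <;> simp_all
  have hsq (y : K) : (y ^ Q) ^ Q = y := by
    rw [← pow_mul, ← sq, ← hK, Nat.card_eq_fintype_card, FiniteField.pow_card]
  have hfib (a : K) : (∑ b : K, if a * a ^ Q + b * b ^ Q = c then 1 else 0) =
      if a * a ^ Q = c then 1 else Q + 1 := by
    rw [← Finset.card_filter]
    split_ifs with h
    · rw [Finset.card_eq_one]
      refine ⟨0, ?_⟩
      ext b
      simp only [h, Finset.mem_filter, Finset.mem_univ, true_and, add_eq_left, Finset.mem_singleton,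
        mul_eq_zero, pow_eq_zero_iff (show Q ≠ 0 by omega), or_self]
    · have hd : (c - a * a ^ Q) ^ Q = c - a * a ^ Q := by
        rw [← hσ, map_sub, map_mul, hσ, hσ, hσ, hsq, hc, mul_comm a]
      have := card_norm_eq hK (sub_ne_zero.mpr (Ne.symm h)) hd
      rw [Nat.card_eq_fintype_card, Fintype.card_subtype] at this
      rw [← this]
      congr 1
      ext b
      simp [eq_sub_iff_add_eq, add_comm]
  rw [Nat.card_eq_fintype_card, Fintype.card_subtype, Finset.card_filter, Fintype.sum_prod_type]
  simp only [hfib]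
  have h1 := card_norm_eq hK hc0 hc
  rw [Nat.card_eq_fintype_card, Fintype.card_subtype] at h1
  rw [Nat.card_eq_fintype_card] at hK
  have h2 := Finset.card_filter_add_card_filter_not (s := (Finset.univ : Finset K))
    (fun a => a * a ^ Q = c)
  rw [h1, Finset.card_univ, hK] at h2
  rw [Finset.sum_ite, Finset.sum_const, Finset.sum_const, h1, smul_eq_mul, smul_eq_mul, mul_one]
  have h3 : (Finset.univ.filter fun a : K => ¬ a * a ^ Q = c).card = Q ^ 2 - Q - 1 := by omega
  have h4 : Q ^ 2 - Q = (Q ^ 2 - Q - 1) + 1 := by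
    have : 2 * Q ≤ Q ^ 2 := by nlinarith
    omega
  rw [h3, h4, Nat.add_sub_cancel]
  ring

/-! ### Norm equations over a product of three rings. -/

section Product

variable {A R K₀ K₁ K₂ : Type*} [CommRing A] [CommRing R] [CommRing K₀] [CommRing K₁] [CommRing K₂]
  [Algebra A R] [Algebra A K₀] [Algebra A K₁] [Algebra A K₂] {σ : R → R} {Q₀ Q₁ Q₂ : ℕ}

theorem card_norm_eq_neg_one_prod
    {π₀ : R →ₐ[A] K₀} {π₁ : R →ₐ[A] K₁} {π₂ : R →ₐ[A] K₂}
    (hπ : Function.Bijective fun r => (π₀ r, π₁ r, π₂ r))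
    (h₀ : ∀ r, π₀ (σ r) = π₀ r ^ Q₀) (h₁ : ∀ r, π₁ (σ r) = π₁ r ^ Q₁)
    (h₂ : ∀ r, π₂ (σ r) = π₂ r ^ Q₂) :
    Nat.card {r : R // r * σ r = -1} = Nat.card {y : K₀ // y * y ^ Q₀ = -1} *
      (Nat.card {y : K₁ // y * y ^ Q₁ = -1} * Nat.card {y : K₂ // y * y ^ Q₂ = -1}) := by
  rw [← Nat.card_prod, ← Nat.card_prod]
  have key (r : R) : r * σ r = -1 ↔ π₀ r * π₀ r ^ Q₀ = -1 ∧ π₁ r * π₁ r ^ Q₁ = -1 ∧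
      π₂ r * π₂ r ^ Q₂ = -1 := by
    rw [← hπ.1.eq_iff]
    simp [h₀, h₁, h₂]
  refine Nat.card_congr (Equiv.ofBijective (fun r => (⟨π₀ r.1, ((key r.1).1 r.2).1⟩,
    ⟨π₁ r.1, ((key r.1).1 r.2).2.1⟩, ⟨π₂ r.1, ((key r.1).1 r.2).2.2⟩)) ⟨?_, ?_⟩)
  · intro r s h
    simp only [Prod.mk.injEq, Subtype.mk.injEq] at h
    exact Subtype.ext (hπ.1 (by simp [h]))
  · rintro ⟨⟨y₀, hy₀⟩, ⟨y₁, hy₁⟩, ⟨y₂, hy₂⟩⟩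
    obtain ⟨r, hr⟩ := hπ.2 (y₀, y₁, y₂)
    simp only [Prod.mk.injEq] at hr
    obtain ⟨rfl, rfl, rfl⟩ := hr
    exact ⟨⟨r, (key r).2 ⟨hy₀, hy₁, hy₂⟩⟩, rfl⟩

theorem card_sum_two_norms_eq_neg_one_prod
    {π₀ : R →ₐ[A] K₀} {π₁ : R →ₐ[A] K₁} {π₂ : R →ₐ[A] K₂}
    (hπ : Function.Bijective fun r => (π₀ r, π₁ r, π₂ r))
    (h₀ : ∀ r, π₀ (σ r) = π₀ r ^ Q₀) (h₁ : ∀ r, π₁ (σ r) = π₁ r ^ Q₁)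
    (h₂ : ∀ r, π₂ (σ r) = π₂ r ^ Q₂) :
    Nat.card {r : R × R // r.1 * σ r.1 + r.2 * σ r.2 = -1} =
      Nat.card {y : K₀ × K₀ // y.1 * y.1 ^ Q₀ + y.2 * y.2 ^ Q₀ = -1} *
      (Nat.card {y : K₁ × K₁ // y.1 * y.1 ^ Q₁ + y.2 * y.2 ^ Q₁ = -1} *
        Nat.card {y : K₂ × K₂ // y.1 * y.1 ^ Q₂ + y.2 * y.2 ^ Q₂ = -1}) := by
  rw [← Nat.card_prod, ← Nat.card_prod]
  have key (r : R × R) : r.1 * σ r.1 + r.2 * σ r.2 = -1 ↔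
      π₀ r.1 * π₀ r.1 ^ Q₀ + π₀ r.2 * π₀ r.2 ^ Q₀ = -1 ∧
      π₁ r.1 * π₁ r.1 ^ Q₁ + π₁ r.2 * π₁ r.2 ^ Q₁ = -1 ∧
      π₂ r.1 * π₂ r.1 ^ Q₂ + π₂ r.2 * π₂ r.2 ^ Q₂ = -1 := by
    rw [← hπ.1.eq_iff]
    simp [h₀, h₁, h₂]
  refine Nat.card_congr (Equiv.ofBijective
    (fun r => (⟨(π₀ r.1.1, π₀ r.1.2), ((key r.1).1 r.2).1⟩,
    ⟨(π₁ r.1.1, π₁ r.1.2), ((key r.1).1 r.2).2.1⟩,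
    ⟨(π₂ r.1.1, π₂ r.1.2), ((key r.1).1 r.2).2.2⟩)) ⟨?_, ?_⟩)
  · intro r s h
    simp only [Prod.mk.injEq, Subtype.mk.injEq] at h
    exact Subtype.ext (Prod.ext (hπ.1 (by simp [h])) (hπ.1 (by simp [h])))
  · rintro ⟨⟨⟨y₀, z₀⟩, hy₀⟩, ⟨⟨y₁, z₁⟩, hy₁⟩, ⟨⟨y₂, z₂⟩, hy₂⟩⟩
    obtain ⟨r, hr⟩ := hπ.2 (y₀, y₁, y₂)
    obtain ⟨s, hs⟩ := hπ.2 (z₀, z₁, z₂)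
    simp only [Prod.mk.injEq] at hr hs
    obtain ⟨rfl, rfl, rfl⟩ := hr
    obtain ⟨rfl, rfl, rfl⟩ := hs
    exact ⟨⟨(r, s), (key (r, s)).2 ⟨hy₀, hy₁, hy₂⟩⟩, rfl⟩

end Product

theorem monic_X_pow_add_one (F : Type*) [Field F] (n : ℕ) [NeZero n] : (X ^ n + 1 : F[X]).Monic := by
  simpa using monic_X_pow_add_C (1 : F) (NeZero.ne n)

/-! ### The ring `F[x]/(xⁿ + 1)`, its conjugation and its trace form. -/

namespace NegaRing

variable (F : Type*) [Field F] (n : ℕ)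

theorem x_pow : x F n ^ n = -1 := by
  have : AdjoinRoot.mk (X ^ n + 1 : F[X]) (X ^ n + 1) = 0 := AdjoinRoot.mk_self
  rw [map_add, map_pow, map_one, AdjoinRoot.mk_X] at this
  exact eq_neg_of_add_eq_zero_left this

theorem toNegaRing_eq_sum (a : Fin n → F) : toNegaRing a = ∑ i, a i • x F n ^ (i : ℕ) := by
  simp [toNegaRing, vecPoly, Algebra.smul_def]

variable {F n} in
theorem toNegaRing_zero : toNegaRing (fun _ => 0 : Fin n → F) = 0 := by
  simp [toNegaRing_eq_sum]

variable {F n} in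
theorem toNegaRing_neg (a : Fin n → F) : toNegaRing (fun m => -a m) = -toNegaRing a := by
  simp [toNegaRing_eq_sum]

variable [NeZero n]

theorem x_mul_inv : x F n * -x F n ^ (n - 1) = 1 := by
  have h1 : n - 1 + 1 = n := Nat.sub_add_cancel (NeZero.one_le)
  rw [mul_neg, ← pow_succ', h1, x_pow, neg_neg]

theorem inv_pow : (-x F n ^ (n - 1)) ^ n = -1 := by
  have h : x F n ^ n * (-x F n ^ (n - 1)) ^ n = 1 := by rw [← mul_pow, x_mul_inv, one_pow]
  rw [x_pow] at h
  linear_combination -h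

/-- The automorphism `a ↦ a'` of `F[x]/(xⁿ + 1)`, which sends `x` to `x⁻¹ = -xⁿ⁻¹`. -/
noncomputable def conj : NegaRing F n →ₐ[F] NegaRing F n :=
  AdjoinRoot.liftAlgHom _ (Algebra.ofId F _) (-x F n ^ (n - 1)) (by simp [inv_pow F n])

@[simp]
theorem conj_x : conj F n (x F n) = -x F n ^ (n - 1) := AdjoinRoot.liftAlgHom_root ..

theorem conj_x_mul_x : conj F n (x F n) * x F n = 1 := by
  rw [conj_x, mul_comm, x_mul_inv]

@[simp]
theorem conj_conj (r : NegaRing F n) : conj F n (conj F n r) = r := by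
  suffices (conj F n).comp (conj F n) = AlgHom.id F _ from DFunLike.congr_fun this r
  apply AdjoinRoot.algHom_ext
  change conj F n (conj F n (x F n)) = x F n
  -- Both `x` and its double conjugate are inverses of `conj x`.
  have h1 := conj_x_mul_x F n
  have h2 := congrArg (conj F n) h1
  rw [map_mul, map_one] at h2
  linear_combination x F n * h2 - conj F n (conj F n (x F n)) * h1

/-- The basis `1, x, …, xⁿ⁻¹` of `F[x]/(xⁿ + 1)`. -/
noncomputable def basis : Module.Basis (Fin n) F (NegaRing F n) :=
  (AdjoinRoot.powerBasis' (monic_X_pow_add_one F n)).basis.reindex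
    (finCongr (by
      rw [AdjoinRoot.powerBasis'_dim]
      simpa using natDegree_X_pow_add_C (n := n) (r := (1 : F))))

@[simp]
theorem basis_apply (i : Fin n) : basis F n i = x F n ^ (i : ℕ) := by
  simp [basis]

theorem toNegaRing_eq (a : Fin n → F) : toNegaRing a = (basis F n).equivFun.symm a := by
  simp [toNegaRing_eq_sum]

variable {F n}

theorem toNegaRing_injective : Function.Injective (toNegaRing : (Fin n → F) → NegaRing F n) := by
  intro a b h
  rw [toNegaRing_eq, toNegaRing_eq] at h
  exact (basis F n).equivFun.symm.injective h

@[simp]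
theorem toNegaRing_equivFun (r : NegaRing F n) : toNegaRing ((basis F n).equivFun r) = r := by
  rw [toNegaRing_eq, LinearEquiv.symm_apply_apply]

theorem toNegaRing_single (i : Fin n) :
    toNegaRing (Pi.single i (1 : F)) = x F n ^ (i : ℕ) := by
  rw [toNegaRing_eq]; simp

theorem toNegaRingPrime_eq (a : Fin n → F) : toNegaRingPrime a = conj F n (toNegaRing a) := by
  rw [toNegaRing, ← aeval_algHom_apply, conj_x, toNegaRingPrime]

variable (F n) in
/-- The constant coefficient of an element of `F[x]/(xⁿ + 1)`. -/
noncomputable def trace : NegaRing F n →ₗ[F] F := (basis F n).coord 0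

theorem trace_x_pow {k : ℕ} (hk : k < n) : trace F n (x F n ^ k) = if k = 0 then 1 else 0 := by
  have := basis_apply F n ⟨k, hk⟩
  rw [trace, ← this, Module.Basis.coord_apply, Module.Basis.repr_self, Finsupp.single_apply]
  simp [Fin.ext_iff]

/-- The product is `x^(i-j)`. For `i < j` it equals `-x^(n+i-j)`, whose exponent lies strictly
between `0` and `n`, so it has no constant term. -/
theorem trace_x_pow_mul_conj (i j : Fin n) :
    trace F n (x F n ^ (i : ℕ) * conj F n (x F n ^ (j : ℕ))) = if i = j then 1 else 0 := by
  have h1 : ∀ k, conj F n (x F n) ^ k * x F n ^ k = 1 := fun k => by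
    rw [← mul_pow, conj_x_mul_x, one_pow]
  rw [map_pow]
  rcases le_or_gt (j : ℕ) i with h | h
  · obtain ⟨k, hk⟩ := Nat.exists_eq_add_of_le h
    have : x F n ^ (i : ℕ) * conj F n (x F n) ^ (j : ℕ) = x F n ^ k := by
      rw [hk, pow_add]; linear_combination x F n ^ k * h1 j
    rw [this, trace_x_pow (by omega)]
    simp only [Fin.ext_iff]
    split_ifs <;> first | rfl | omega
  · obtain ⟨k, hk⟩ := Nat.exists_eq_add_of_lt (h.trans j.2)
    have : x F n ^ (i : ℕ) * conj F n (x F n) ^ (j : ℕ) = -x F n ^ (i + (n - j) : ℕ) := by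
      have h2 : x F n ^ (n - j : ℕ) * x F n ^ (j : ℕ) = -1 := by
        rw [← pow_add, Nat.sub_add_cancel j.2.le, x_pow]
      rw [pow_add]
      linear_combination (-x F n ^ (i : ℕ) * x F n ^ (n - j : ℕ)) * h1 j +
        x F n ^ (i : ℕ) * conj F n (x F n) ^ (j : ℕ) * h2
    rw [this, map_neg, trace_x_pow (by omega), if_neg (by omega), if_neg (by omega), neg_zero]

theorem trace_mul_conj (u v : Fin n → F) :
    trace F n (toNegaRing u * conj F n (toNegaRing v)) = u ⬝ᵥ v := by
  simp only [toNegaRing_eq_sum, map_sum, map_smul, Finset.sum_mul_sum, smul_mul_smul_comm,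
    trace_x_pow_mul_conj, dotProduct]
  simp

theorem trace_conj (r : NegaRing F n) : trace F n (conj F n r) = trace F n r := by
  obtain ⟨a, rfl⟩ : ∃ a, toNegaRing a = r := ⟨_, toNegaRing_equivFun r⟩
  simp only [toNegaRing_eq_sum, map_sum, map_smul]
  refine Finset.sum_congr rfl fun i _ => ?_
  have := trace_x_pow_mul_conj (F := F) 0 i
  rw [Fin.val_zero, pow_zero, one_mul] at this
  rw [this, trace_x_pow i.2]
  congr 1
  exact if_congr (by rw [Fin.ext_iff, eq_comm, Fin.val_zero]) rfl rfl

theorem eq_zero_of_trace_mul_eq_zero {r : NegaRing F n}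
    (h : ∀ s, trace F n (s * r) = 0) : r = 0 := by
  apply (basis F n).equivFun.injective
  rw [map_zero]
  ext i
  have h1 := h (conj F n (toNegaRing (Pi.single i 1)))
  rw [← toNegaRing_equivFun r, mul_comm, trace_mul_conj] at h1
  simpa using h1

theorem trace_toNegaRing_mul_conj_x_pow (a : Fin n → F) (i : Fin n) :
    trace F n (toNegaRing a * conj F n (x F n ^ (i : ℕ))) = a i := by
  rw [← toNegaRing_single, trace_mul_conj]; simp

/-- The negashift is multiplication by `x`: after the reindexing `j = i + k`, the condition `i ≤ j`
fails exactly when `i + k` wraps past `n`, and there `xⁿ = -1` supplies the sign. -/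
theorem toNegaRing_negacirculant (a : Fin n → F) (i : Fin n) :
    toNegaRing (negacirculant a i) = x F n ^ (i : ℕ) * toNegaRing a := by
  rw [toNegaRing_eq_sum, toNegaRing_eq_sum, Finset.mul_sum, ← Equiv.sum_comp (Equiv.addLeft i)]
  refine Finset.sum_congr rfl fun k _ => ?_
  simp only [Equiv.coe_addLeft, negacirculant, Matrix.of_apply, add_sub_cancel_left,
    mul_smul_comm, ← pow_add, Fin.le_def, Fin.val_add]
  rcases lt_or_ge ((i : ℕ) + k) n with h | h
  · rw [Nat.mod_eq_of_lt h, if_pos (by omega)]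
  · have h2 : ((i : ℕ) + k) % n = i + k - n := by
      rw [Nat.mod_eq_sub_mod h, Nat.mod_eq_of_lt (by omega)]
    have h3 : x F n ^ ((i : ℕ) + k) = -x F n ^ ((i : ℕ) + k - n) := by
      conv_lhs => rw [← Nat.sub_add_cancel h, pow_add, x_pow, mul_neg_one]
    rw [h2, if_neg (by omega), h3, smul_neg, neg_smul]

/-- Entry `(j, i)` of the matrix is `trace (x^j a conj(x^i))`; as the trace is invariant under
conjugation, this is coefficient `j` of `x^i conj a`. -/
theorem toNegaRing_negacirculant_transpose (a : Fin n → F) (i : Fin n) :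
    toNegaRing ((negacirculant a).transpose i) = x F n ^ (i : ℕ) * conj F n (toNegaRing a) := by
  rw [← toNegaRing_equivFun (x F n ^ (i : ℕ) * conj F n (toNegaRing a))]
  congr 1
  ext j
  rw [← trace_toNegaRing_mul_conj_x_pow ((basis F n).equivFun _), toNegaRing_equivFun,
    Matrix.transpose_apply, ← trace_toNegaRing_mul_conj_x_pow (negacirculant a j),
    toNegaRing_negacirculant, ← trace_conj]
  simp only [map_mul, conj_conj]
  congr 1
  ring

end NegaRing

open NegaRing

/-! ### Codes as submodules, and self-duality as an equation in the ring. -/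

section Codes

variable {F : Type*} [Field F] {n : ℕ} [NeZero n] {l : ℕ}

variable (F n l) in
/-- The identification of `F^(ln)` with `(F[x]/(xⁿ + 1))^l`. -/
noncomputable def blockEquiv : (Fin l × Fin n → F) ≃ₗ[F] (Fin l → NegaRing F n) :=
  (LinearEquiv.curry F F (Fin l) (Fin n)).trans
    (LinearEquiv.piCongrRight fun _ => (basis F n).equivFun.symm)

theorem blockEquiv_apply (v : Fin l × Fin n → F) :
    blockEquiv F n l v = fun j => toNegaRing fun i => v (j, i) := by
  ext j
  rw [toNegaRing_eq]
  rfl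

theorem isGeneratedBy_iff {C : Submodule F (Fin l × Fin n → F)} {S : Set (Fin l → NegaRing F n)} :
    IsGeneratedBy C S ↔ ∀ v, v ∈ C ↔ blockEquiv F n l v ∈ Submodule.span (NegaRing F n) S := by
  simp only [blockEquiv_apply]; rfl

theorem trace_sum_mul_conj (u v : Fin l × Fin n → F) :
    trace F n (∑ j, blockEquiv F n l u j * conj F n (blockEquiv F n l v j)) = u ⬝ᵥ v := by
  simp only [map_sum, blockEquiv_apply, trace_mul_conj]
  simp [dotProduct, Fintype.sum_prod_type]

/-- A code is self-dual iff the submodule attached to it is self-dual for the Hermitian form. -/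
theorem IsGeneratedBy.isSelfDual_iff {C : Submodule F (Fin l × Fin n → F)}
    {S : Set (Fin l → NegaRing F n)} (h : IsGeneratedBy C S) :
    IsSelfDual C ↔ ∀ w : Fin l → NegaRing F n, w ∈ Submodule.span (NegaRing F n) S ↔
      ∀ s ∈ S, ∑ j, w j * conj F n (s j) = 0 := by
  rw [isGeneratedBy_iff] at h
  rw [IsSelfDual, (blockEquiv F n l).toEquiv.forall_congr]
  intro v
  rw [LinearEquiv.coe_toEquiv, ← h]
  refine iff_congr Iff.rfl ⟨fun hv => ?_, fun hv c hc => ?_⟩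
  · have key : ∀ t ∈ Submodule.span (NegaRing F n) S,
        trace F n (∑ j, blockEquiv F n l v j * conj F n (t j)) = 0 := fun t ht => by
      obtain ⟨c, rfl⟩ := (blockEquiv F n l).surjective t
      rw [trace_sum_mul_conj, hv c ((h c).2 ht)]
    intro s hs
    refine eq_zero_of_trace_mul_eq_zero fun r => ?_
    -- Scaling `s` by `conj r` multiplies the Hermitian product by `r`; nondegeneracy of the trace
    -- form then upgrades orthogonality over `F` to orthogonality over the ring.
    rw [← key (conj F n r • s) (Submodule.smul_mem _ _ (Submodule.subset_span hs))]
    simp only [Pi.smul_apply, smul_eq_mul, map_mul, conj_conj, Finset.mul_sum, mul_left_comm]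
  · have hc := (h c).1 hc
    rw [← trace_sum_mul_conj]
    suffices ∀ t ∈ Submodule.span (NegaRing F n) S,
        ∑ j, blockEquiv F n l v j * conj F n (t j) = 0 by rw [this _ hc, map_zero]
    intro t ht
    induction ht using Submodule.span_induction with
    | mem s hs => exact hv s hs
    | zero => simp
    | add s t _ _ hs ht => simp [mul_add, Finset.sum_add_distrib, hs, ht]
    | smul r s _ hs =>
      simp only [Pi.smul_apply, smul_eq_mul, map_mul, mul_left_comm _ (conj F n r),
        ← Finset.mul_sum, hs, mul_zero]

open scoped Pointwise in
-- Over `F`, the ring-span of `s` is spanned by the products `x^i • s a`, which are the rows of `G`.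
theorem isGeneratedBy_rowCode {k : ℕ} {G : Matrix (Fin k × Fin n) (Fin l × Fin n) F}
    {s : Fin k → Fin l → NegaRing F n}
    (hG : ∀ a i j, toNegaRing (fun m => G (a, i) (j, m)) = x F n ^ (i : ℕ) * s a j) :
    IsGeneratedBy (rowCode G) (Set.range s) := by
  rw [isGeneratedBy_iff]
  intro v
  rw [← Submodule.restrictScalars_mem F (Submodule.span (NegaRing F n) _),
    ← Submodule.span_smul_of_span_eq_top (basis F n).span_eq,
    show Set.range (basis F n) • Set.range s = blockEquiv F n l '' Set.range G.row from ?_,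
    ← LinearEquiv.coe_coe, Submodule.span_image,
    LinearEquiv.coe_coe, Submodule.mem_map_equiv, LinearEquiv.symm_apply_apply, rowCode]
  have hrow (a i) : basis F n i • s a = blockEquiv F n l (G.row (a, i)) := by
    rw [blockEquiv_apply, basis_apply]
    ext j
    exact (hG a i j).symm
  ext w
  simp only [Set.mem_smul, Set.mem_range, exists_exists_eq_and, Set.mem_image, Prod.exists, hrow]
  constructor
  · rintro ⟨i, a, rfl⟩
    exact ⟨_, ⟨a, i, rfl⟩, rfl⟩
  · rintro ⟨_, ⟨a, i, rfl⟩, rfl⟩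
    exact ⟨i, a, rfl⟩

theorem toNegaRing_one_apply (i : Fin n) :
    toNegaRing (fun m => (1 : Matrix (Fin n) (Fin n) F) i m) = x F n ^ (i : ℕ) := by
  rw [← toNegaRing_single]
  congr 1
  ext m
  simp [Matrix.one_apply, Pi.single_apply, eq_comm]

theorem isGeneratedBy_doubleNegacirculantCode (h : Fin n → F) :
    IsGeneratedBy (doubleNegacirculantCode h) {![1, toNegaRing h]} := by
  have := isGeneratedBy_rowCode (s := fun _ : Fin 1 => ![1, toNegaRing h])
    (G := Matrix.comp (Fin 1) (Fin 2) (Fin n) (Fin n) F !![1, negacirculant h]) ?_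
  · rwa [Set.range_const] at this
  · intro a i j
    fin_cases a
    fin_cases j
    · simpa using toNegaRing_one_apply i
    · simpa using toNegaRing_negacirculant h i

theorem isGeneratedBy_fourNegacirculantCode (a b : Fin n → F) :
    IsGeneratedBy (fourNegacirculantCode a b) {![1, 0, toNegaRing a, toNegaRing b],
      ![0, 1, -toNegaRingPrime b, toNegaRingPrime a]} := by
  have := isGeneratedBy_rowCode (s := ![![1, 0, toNegaRing a, toNegaRing b],
      ![0, 1, -toNegaRingPrime b, toNegaRingPrime a]])
    (G := Matrix.comp (Fin 2) (Fin 4) (Fin n) (Fin n) F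
      !![1, 0, negacirculant a, negacirculant b;
        0, 1, -(negacirculant b).transpose, (negacirculant a).transpose]) ?_
  · simpa [Matrix.range_cons, Set.pair_comm, fourNegacirculantCode] using this
  · intro c i j
    rw [toNegaRingPrime_eq, toNegaRingPrime_eq]
    fin_cases c <;> fin_cases j
    · simpa using toNegaRing_one_apply i
    · simpa using toNegaRing_zero
    · simpa using toNegaRing_negacirculant a i
    · simpa using toNegaRing_negacirculant b i
    · simpa using toNegaRing_zero
    · simpa using toNegaRing_one_apply i
    · have := toNegaRing_neg ((negacirculant b).transpose i)
      rw [toNegaRing_negacirculant_transpose] at this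
      simpa using this
    · have := toNegaRing_negacirculant_transpose a i
      simpa [Matrix.transpose] using! this

theorem isSelfDual_doubleNegacirculantCode_iff (h : Fin n → F) :
    IsSelfDual (doubleNegacirculantCode h) ↔ toNegaRing h * conj F n (toNegaRing h) = -1 := by
  rw [(isGeneratedBy_doubleNegacirculantCode h).isSelfDual_iff]
  generalize toNegaRing h = r
  simp only [Submodule.mem_span_singleton, Set.mem_singleton_iff, forall_eq, Fin.sum_univ_two,
    Matrix.cons_val_zero, Matrix.cons_val_one, map_one, mul_one]
  constructor
  · intro H
    have := (H ![1, r]).1 ⟨1, one_smul _ _⟩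
    simp only [Matrix.cons_val_zero, Matrix.cons_val_one] at this
    linear_combination this
  · refine fun H w => ⟨?_, fun hw => ⟨w 0, ?_⟩⟩
    · rintro ⟨c, rfl⟩
      simp only [Pi.smul_apply, Matrix.cons_val_zero, Matrix.cons_val_one, smul_eq_mul]
      linear_combination c * H
    · ext j
      fin_cases j
      · simp
      · simp only [Fin.mk_one, Pi.smul_apply, Matrix.cons_val_one, smul_eq_mul]
        simp only [Matrix.cons_val_fin_one]
        linear_combination r * hw - w 1 * H

/-- The two generators are always orthogonal to each other, and each pairs with itself to `1 + a a'
+ b b'`. Conversely, the block `(a b; -b' a')` has determinant `a a' + b b' = -1`, so the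
orthogonality relations can be solved for the last two coordinates of `w` in terms of the first two.
-/
theorem isSelfDual_fourNegacirculantCode_iff (a b : Fin n → F) :
    IsSelfDual (fourNegacirculantCode a b) ↔ toNegaRing a * conj F n (toNegaRing a) +
      toNegaRing b * conj F n (toNegaRing b) = -1 := by
  rw [(isGeneratedBy_fourNegacirculantCode a b).isSelfDual_iff, toNegaRingPrime_eq,
    toNegaRingPrime_eq]
  generalize toNegaRing a = r
  generalize toNegaRing b = s
  simp only [Submodule.mem_span_pair, Set.mem_insert_iff, Set.mem_singleton_iff, forall_eq_or_imp,
    forall_eq, Fin.sum_univ_four, Matrix.cons_val, map_one, map_zero, map_neg, conj_conj, mul_one,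
    mul_zero, mul_neg]
  constructor
  · intro H
    have := ((H ![1, 0, r, s]).1 ⟨1, 0, by simp⟩).1
    simp only [Matrix.cons_val] at this
    linear_combination this
  · refine fun H w => ⟨?_, fun ⟨h1, h2⟩ => ⟨w 0, w 1, ?_⟩⟩
    · rintro ⟨c, d, rfl⟩
      simp only [Pi.smul_apply, Pi.add_apply, Matrix.cons_val, smul_eq_mul]
      constructor
      · linear_combination c * H
      · linear_combination d * H
    · ext j
      fin_cases j
      · simp
      · simp
      · simp
        linear_combination r * h1 - conj F n s * h2 - w 2 * H
      · simp
        linear_combination s * h1 + conj F n r * h2 - w 3 * H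

theorem IsGeneratedBy.span_eq {C : Submodule F (Fin l × Fin n → F)}
    {S T : Set (Fin l → NegaRing F n)} (hS : IsGeneratedBy C S) (hT : IsGeneratedBy C T) :
    Submodule.span (NegaRing F n) S = Submodule.span (NegaRing F n) T := by
  rw [isGeneratedBy_iff] at hS hT
  ext w
  obtain ⟨v, rfl⟩ := (blockEquiv F n l).surjective w
  rw [← hS, hT]

theorem doubleNegacirculantCode_injective :
    Function.Injective (doubleNegacirculantCode : (Fin n → F) → _) := by
  intro g h hgh
  have h1 := isGeneratedBy_doubleNegacirculantCode g
  rw [hgh] at h1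
  have h2 := h1.span_eq (isGeneratedBy_doubleNegacirculantCode h)
  have h3 : ![1, toNegaRing g] ∈ Submodule.span (NegaRing F n) {![1, toNegaRing h]} := by
    rw [← h2]; exact Submodule.mem_span_singleton_self _
  obtain ⟨c, hc⟩ := Submodule.mem_span_singleton.1 h3
  have e0 := congrFun hc 0
  have e1 := congrFun hc 1
  simp at e0 e1
  apply toNegaRing_injective
  rw [← e1, e0, one_mul]

theorem fourNegacirculantCode_injective {a b c d : Fin n → F}
    (h : fourNegacirculantCode a b = fourNegacirculantCode c d) : a = c ∧ b = d := by
  have h1 := isGeneratedBy_fourNegacirculantCode a b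
  rw [h] at h1
  have h2 := h1.span_eq (isGeneratedBy_fourNegacirculantCode c d)
  have h3 := h2 ▸ Submodule.subset_span (Set.mem_insert ![1, 0, toNegaRing a, toNegaRing b] _)
  obtain ⟨u, v, hc⟩ := Submodule.mem_span_pair.1 h3
  have e0 := congrFun hc 0
  have e1 := congrFun hc 1
  have e2 := congrFun hc 2
  have e3 := congrFun hc 3
  simp at e0 e1 e2 e3
  subst e0 e1
  constructor <;> apply toNegaRing_injective
  · simpa using e2.symm
  · simpa using e3.symm

theorem ncard_selfDual_doubleNegacirculantCode :
    {C : Submodule F (Fin 2 × Fin n → F) | IsSelfDual C ∧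
      ∃ h : Fin n → F, C = doubleNegacirculantCode h ∧
        IsGeneratedBy C {![1, toNegaRing h]}}.ncard =
      Nat.card {r : NegaRing F n // r * conj F n r = -1} := by
  rw [← Nat.card_coe_set_eq]
  refine (Nat.card_congr (Equiv.ofBijective
    (fun r => ⟨doubleNegacirculantCode ((basis F n).equivFun r.1),
      (isSelfDual_doubleNegacirculantCode_iff _).2 (by rw [toNegaRing_equivFun]; exact r.2),
      _, rfl, isGeneratedBy_doubleNegacirculantCode _⟩) ⟨?_, ?_⟩)).symm
  · intro r s h
    exact Subtype.ext ((basis F n).equivFun.injective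
      (doubleNegacirculantCode_injective (congrArg Subtype.val h)))
  · rintro ⟨_, hC, h, rfl, -⟩
    refine ⟨⟨toNegaRing h, (isSelfDual_doubleNegacirculantCode_iff h).1 hC⟩, Subtype.ext ?_⟩
    simp only [toNegaRing_eq, LinearEquiv.apply_symm_apply]

theorem ncard_selfDual_fourNegacirculantCode :
    {C : Submodule F (Fin 4 × Fin n → F) | IsSelfDual C ∧
      ∃ a b : Fin n → F, C = fourNegacirculantCode a b ∧
        IsGeneratedBy C {![1, 0, toNegaRing a, toNegaRing b],
          ![0, 1, -toNegaRingPrime b, toNegaRingPrime a]}}.ncard =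
      Nat.card {r : NegaRing F n × NegaRing F n //
        r.1 * conj F n r.1 + r.2 * conj F n r.2 = -1} := by
  rw [← Nat.card_coe_set_eq]
  refine (Nat.card_congr (Equiv.ofBijective
    (fun r => ⟨fourNegacirculantCode ((basis F n).equivFun r.1.1) ((basis F n).equivFun r.1.2),
      (isSelfDual_fourNegacirculantCode_iff _ _).2
        (by rw [toNegaRing_equivFun, toNegaRing_equivFun]; exact r.2),
      _, _, rfl, isGeneratedBy_fourNegacirculantCode _ _⟩) ⟨?_, ?_⟩)).symm
  · intro r s h
    obtain ⟨h1, h2⟩ := fourNegacirculantCode_injective (congrArg Subtype.val h)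
    exact Subtype.ext (Prod.ext ((basis F n).equivFun.injective h1)
      ((basis F n).equivFun.injective h2))
  · rintro ⟨_, hC, a, b, rfl, -⟩
    refine ⟨⟨(toNegaRing a, toNegaRing b), (isSelfDual_fourNegacirculantCode_iff a b).1 hC⟩,
      Subtype.ext ?_⟩
    simp only [toNegaRing_eq, LinearEquiv.apply_symm_apply]

end Codes

open NegaRing

/-! ### Frobenius on the components of the ring. -/

theorem root_mul_pow_eq_one {F : Type*} [Field F] {n : ℕ} {P : F[X]} (d : P ∣ X ^ n + 1)
    {Q : ℕ} (hQ : 2 * n ∣ Q + 1) :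
    AdjoinRoot.root P * AdjoinRoot.root P ^ Q = 1 := by
  have h1 : AdjoinRoot.root P ^ n = -1 := by
    have := AdjoinRoot.mk_eq_zero.2 d
    rw [map_add, map_pow, map_one, AdjoinRoot.mk_X] at this
    exact eq_neg_of_add_eq_zero_left this
  obtain ⟨c, hc⟩ := hQ
  rw [← pow_succ', hc, mul_assoc, mul_comm, mul_assoc, pow_mul, h1, mul_comm, pow_mul, neg_one_sq,
    one_pow]

section FiniteField

variable {F : Type*} [Field F] [Fintype F]

/-- The iterated Frobenius `y ↦ y ^ |F|ᵏ` of an `F`-algebra. -/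
theorem exists_algHom_eq_pow_card_pow (K : Type*) [CommRing K] [Algebra F K] (k : ℕ) :
    ∃ φ : K →ₐ[F] K, ∀ y, φ y = y ^ Fintype.card F ^ k :=
  ⟨FiniteField.frobeniusAlgHom F K ^ k, fun y => by
    rw [AlgHom.coe_pow, FiniteField.coe_frobeniusAlgHom, pow_iterate]⟩

theorem natCast_ne_zero_of_coprime_card {m : ℕ} (h : m.Coprime (Fintype.card F)) :
    (m : F) ≠ 0 := by
  intro h0
  have h1 := (Nat.isCoprime_iff_coprime.2 h).map (Int.castRingHom F)
  simp [h0] at h1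

theorem natDegree_eq_orderOf_of_dvd_cyclotomic {m : ℕ} (h : m.Coprime (Fintype.card F)) {P : F[X]}
    (hP : Irreducible P) (hdvd : P ∣ cyclotomic m F) :
    P.natDegree = orderOf (Fintype.card F : ZMod m) := by
  obtain ⟨r, _, f, hr, hrf⟩ := FiniteField.card' F
  have := Fact.mk hr
  have hrm : r.Coprime m := by
    rw [hrf] at h
    exact (Nat.Coprime.coprime_dvd_right (dvd_pow_self r f.ne_zero) h).symm
  rw [natDegree_of_dvd_cyclotomic_of_irreducible hrf hrm hdvd hP, hrf, ← orderOf_units,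
    ZMod.coe_unitOfCoprime]

/-- An irreducible polynomial of degree at least two is self-reciprocal if the Frobenius inverts
one of its roots. -/
theorem reverse_eq_self_of_root_mul_pow_eq_one {P : F[X]} (hP : Irreducible P) (hm : P.Monic)
    (hd : 2 ≤ P.natDegree) {k : ℕ}
    (hz : AdjoinRoot.root P * AdjoinRoot.root P ^ Fintype.card F ^ k = 1) : P.reverse = P := by
  obtain ⟨φ, hφ⟩ := exists_algHom_eq_pow_card_pow (F := F) (AdjoinRoot P) k
  set z := AdjoinRoot.root P
  -- `φ z` is a root of `P` with inverse `z`, so `z` is a root of the reverse.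
  let : Invertible (φ z) := ⟨z, by rw [hφ, hz], by rw [hφ, mul_comm, hz]⟩
  have hroot : aeval z P.reverse = 0 := by
    have h1 : aeval (φ z) P = 0 := by
      rw [aeval_algHom_apply, AdjoinRoot.aeval_eq, AdjoinRoot.mk_self, map_zero]
    exact (eval₂_reverse_eq_zero_iff (algebraMap F _) (φ z) P).2 h1
  rw [AdjoinRoot.aeval_eq, AdjoinRoot.mk_eq_zero] at hroot
  have h2 := eq_leadingCoeff_mul_of_monic_of_dvd_of_natDegree_le hm hroot
    (reverse_natDegree_le P)
  -- The reverse is now a constant times `P`; comparing values at `1`, where `P` does not vanish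
  -- because its degree exceeds one, shows that the constant is `1`.
  have h3 : eval 1 P.reverse = eval 1 P := by
    let : Invertible (1 : F) := invertibleOne
    simpa using eval₂_reverse_mul_pow (RingHom.id F) 1 P
  have h4 : eval 1 P ≠ 0 := fun h0 => by
    have := natDegree_eq_of_degree_eq_some (n := 1) (degree_eq_one_of_irreducible_of_root hP h0)
    omega
  rw [h2, eval_mul, eval_C, mul_eq_right₀ h4] at h3
  rw [h2, h3, C_1, one_mul]

theorem natCard_adjoinRoot {P : F[X]} (hP : P ≠ 0) :
    Nat.card (AdjoinRoot P) = Fintype.card F ^ P.natDegree := by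
  have := (AdjoinRoot.powerBasis hP).finite
  rw [Module.natCard_eq_pow_finrank (K := F), (AdjoinRoot.powerBasis hP).finrank,
    AdjoinRoot.powerBasis_dim, Nat.card_eq_fintype_card]

/-- Coprimality gives injectivity; both sides have the same finite cardinality, so surjectivity
follows. -/
theorem adjoinRoot_prod_bijective {f P₀ P₁ P₂ : F[X]} (hf : f ≠ 0) (h : f = P₀ * P₁ * P₂)
    (h₀₁ : IsCoprime P₀ P₁) (h₂ : IsCoprime (P₀ * P₁) P₂) (d₀ : P₀ ∣ f) (d₁ : P₁ ∣ f)
    (d₂ : P₂ ∣ f) :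
    Function.Bijective fun r : AdjoinRoot f => (AdjoinRoot.algHomOfDvd F f P₀ d₀ r,
      AdjoinRoot.algHomOfDvd F f P₁ d₁ r, AdjoinRoot.algHomOfDvd F f P₂ d₂ r) := by
  have n₀ := ne_zero_of_dvd_ne_zero hf d₀
  have n₁ := ne_zero_of_dvd_ne_zero hf d₁
  have n₂ := ne_zero_of_dvd_ne_zero hf d₂
  have i₀ := (AdjoinRoot.powerBasis n₀).finite
  have i₁ := (AdjoinRoot.powerBasis n₁).finite
  have i₂ := (AdjoinRoot.powerBasis n₂).finite
  have := Module.finite_of_finite F (M := AdjoinRoot P₀)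
  have := Module.finite_of_finite F (M := AdjoinRoot P₁)
  have := Module.finite_of_finite F (M := AdjoinRoot P₂)
  have hmk (P : F[X]) (d : P ∣ f) (g : F[X]) :
      AdjoinRoot.algHomOfDvd F f P d (AdjoinRoot.mk f g) = AdjoinRoot.mk P g := by
    rw [← AdjoinRoot.aeval_eq, ← aeval_algHom_apply, AdjoinRoot.algHomOfDvd_root,
      AdjoinRoot.aeval_eq]
  refine Function.Injective.bijective_of_nat_card_le ?_ ?_
  · let Ψ := (AdjoinRoot.algHomOfDvd F f P₀ d₀).prod
      ((AdjoinRoot.algHomOfDvd F f P₁ d₁).prod (AdjoinRoot.algHomOfDvd F f P₂ d₂))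
    refine (injective_iff_map_eq_zero Ψ).2 fun r hr => ?_
    obtain ⟨g, rfl⟩ := AdjoinRoot.mk_surjective r
    simp only [Ψ, AlgHom.prod_apply, hmk, Prod.mk_eq_zero, AdjoinRoot.mk_eq_zero] at hr
    rw [AdjoinRoot.mk_eq_zero, h]
    exact h₂.mul_dvd (h₀₁.mul_dvd hr.1 hr.2.1) hr.2.2
  · rw [Nat.card_prod, Nat.card_prod, natCard_adjoinRoot n₀, natCard_adjoinRoot n₁,
      natCard_adjoinRoot n₂, natCard_adjoinRoot hf, h, natDegree_mul (mul_ne_zero n₀ n₁) n₂,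
      natDegree_mul n₀ n₁, pow_add, pow_add, mul_assoc]

/-- On a component of `F[x]/(xⁿ + 1)` where some power of the Frobenius inverts the root, the
conjugation is that power of the Frobenius. -/
theorem algHomOfDvd_conj {n : ℕ} [NeZero n] {P : F[X]} (d : P ∣ X ^ n + 1) {k : ℕ}
    (hz : AdjoinRoot.root P * AdjoinRoot.root P ^ Fintype.card F ^ k = 1) (r : NegaRing F n) :
    AdjoinRoot.algHomOfDvd F _ P d (conj F n r) =
      AdjoinRoot.algHomOfDvd F _ P d r ^ Fintype.card F ^ k := by
  obtain ⟨φ, hφ⟩ := exists_algHom_eq_pow_card_pow (F := F) (AdjoinRoot P) k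
  rw [← hφ]
  suffices (AdjoinRoot.algHomOfDvd F _ P d).comp (conj F n) =
    φ.comp (AdjoinRoot.algHomOfDvd F _ P d) from DFunLike.congr_fun this r
  apply AdjoinRoot.algHom_ext
  have h1 := congrArg (AdjoinRoot.algHomOfDvd F _ P d) (conj_x_mul_x F n)
  rw [map_mul, map_one, AdjoinRoot.algHomOfDvd_root] at h1
  rw [AlgHom.comp_apply, AlgHom.comp_apply, AdjoinRoot.algHomOfDvd_root, hφ]
  linear_combination AdjoinRoot.root P ^ Fintype.card F ^ k * h1 -
    AdjoinRoot.algHomOfDvd F _ P d (conj F n (x F n)) * hz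

theorem irreducible_X_sq_add_one (h : Fintype.card F % 4 = 3) : Irreducible (X ^ 2 + 1 : F[X]) := by
  have hm := monic_X_pow_add_one F 2
  have hd : (X ^ 2 + 1 : F[X]).natDegree = 2 := by
    simpa using natDegree_X_pow_add_C (n := 2) (r := (1 : F))
  rw [hm.irreducible_iff_roots_eq_zero_of_degree_le_three (by omega) (by omega)]
  refine Multiset.eq_zero_of_forall_notMem fun a ha => ?_
  have h1 := (mem_roots'.1 ha).2
  simp only [IsRoot, eval_add, eval_pow, eval_X, eval_one] at h1
  exact FiniteField.isSquare_neg_one_iff.1 ⟨a, by linear_combination -h1⟩ h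

end FiniteField

/-! ### The factorization of `x^(2p) + 1`. -/

theorem cyclotomic_four (R : Type*) [CommRing R] : cyclotomic 4 R = X ^ 2 + 1 := by
  have := cyclotomic_prime_pow_eq_geom_sum (R := R) (n := 1) Nat.prime_two
  norm_num [Finset.sum_range_succ] at this
  rw [this, add_comm]

theorem X_pow_two_mul_prime_add_one_eq (R : Type*) [CommRing R] {p : ℕ} (hp : p.Prime)
    (h2 : p ≠ 2) : (X ^ (2 * p) + 1 : R[X]) = (X ^ 2 + 1) * cyclotomic (4 * p) R := by
  have hdiv : ¬ p ∣ 4 := fun h => h2 <|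
    (Nat.prime_dvd_prime_iff_eq hp Nat.prime_two).1 (hp.dvd_of_dvd_pow (n := 2) (by simpa using h))
  have := cyclotomic_expand_eq_cyclotomic_mul hp hdiv R
  rw [cyclotomic_four, mul_comm (cyclotomic _ _)] at this
  rw [← this]
  simp [← pow_mul, mul_comm]

/-- Every irreducible factor has degree `ord_{4p}(q) = p - 1`, while the total degree is `φ(4p) =
2(p - 1)`, so there are exactly two. -/
theorem exists_irreducible_factors_cyclotomic {F : Type*} [Field F] [Fintype F] {p : ℕ}
    (hp : p.Prime) (h2 : p ≠ 2) (hcop : (4 * p).Coprime (Fintype.card F))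
    (hord : orderOf (Fintype.card F : ZMod (4 * p)) = p - 1) :
    ∃ g₁ g₂ : F[X], g₁.Monic ∧ g₂.Monic ∧ Irreducible g₁ ∧ Irreducible g₂ ∧
      g₁.natDegree = p - 1 ∧ g₂.natDegree = p - 1 ∧ cyclotomic (4 * p) F = g₁ * g₂ := by
  have hp3 : 3 ≤ p := by have := hp.two_le; omega
  have hdeg : (cyclotomic (4 * p) F).natDegree = 2 * (p - 1) := by
    rw [natDegree_cyclotomic, Nat.totient_mul, Nat.totient_prime hp]
    · rfl
    · exact (Nat.Coprime.pow_left 2 ((Nat.coprime_primes Nat.prime_two hp).2 h2.symm) :)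
  have hmon := cyclotomic.monic (4 * p) F
  obtain ⟨g₁, hm₁, hi₁, g₂, hg⟩ := exists_monic_irreducible_factor (cyclotomic (4 * p) F)
    (not_isUnit_of_natDegree_pos _ (by omega))
  have hm₂ : g₂.Monic := hm₁.of_mul_monic_left (hg ▸ hmon)
  have hd₁ : g₁.natDegree = p - 1 := by
    rw [natDegree_eq_orderOf_of_dvd_cyclotomic hcop hi₁ ⟨g₂, hg⟩, hord]
  have hd₂ : g₂.natDegree = p - 1 := by
    have := hm₁.natDegree_mul hm₂
    rw [← hg, hdeg] at this
    omega
  obtain ⟨g₃, hm₃, hi₃, hdvd⟩ := exists_monic_irreducible_factor g₂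
    (not_isUnit_of_natDegree_pos _ (by omega))
  have hd₃ : g₃.natDegree = p - 1 := by
    rw [natDegree_eq_orderOf_of_dvd_cyclotomic hcop hi₃ (hdvd.trans ⟨g₁, by rw [hg, mul_comm]⟩),
      hord]
  have h₃ := eq_of_monic_of_dvd_of_natDegree_le hm₃ hm₂ hdvd (by omega)
  exact ⟨g₁, g₂, hm₁, hm₂, hi₁, h₃ ▸ hi₃, hd₁, hd₂, hg⟩

/-- The exponent is odd. Modulo `4`, `q` is `-1`. Modulo `p` the power is `±1`, and `+1` would make
the even order of `q` divide an odd number. -/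
theorem four_mul_prime_dvd_pow_add_one {p q : ℕ} (hp : p.Prime) (hp4 : p % 4 = 3)
    (hq4 : q % 4 = 3) (hordp : orderOf (q : ZMod p) % 4 = 2) :
    4 * p ∣ q ^ ((p - 1) / 2) + 1 := by
  have := Fact.mk hp
  have hodd : Odd ((p - 1) / 2) := by rw [Nat.odd_iff]; omega
  have h4 : 4 ∣ q ^ ((p - 1) / 2) + 1 := by
    have := hodd.nat_add_dvd_pow_add_pow q 1
    rw [one_pow] at this
    exact dvd_trans (by omega) this
  have hp' : p ∣ q ^ ((p - 1) / 2) + 1 := by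
    rw [← CharP.cast_eq_zero_iff (ZMod p) p]
    push_cast
    have hq0 : (q : ZMod p) ≠ 0 := by
      intro h
      rw [h, orderOf_zero] at hordp
      omega
    have hsq : ((q : ZMod p) ^ ((p - 1) / 2)) ^ 2 = 1 := by
      rw [← pow_mul, Nat.div_mul_cancel (by omega), ZMod.pow_card_sub_one_eq_one hq0]
    rcases mul_self_eq_one_iff.1 ((sq _).symm.trans hsq) with h | h
    · have := orderOf_dvd_of_pow_eq_one h
      have h2 : 2 ∣ (p - 1) / 2 := dvd_trans (by omega) this
      rw [Nat.odd_iff] at hodd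
      omega
    · rw [h]; simp
  refine Nat.Coprime.mul_dvd_of_dvd_of_dvd ?_ h4 hp'
  exact (Nat.Coprime.pow_left 2 ((Nat.coprime_primes Nat.prime_two hp).2 (by omega)) :)

/-! ### Assembly of the counts. -/

theorem theorem4p3 {F : Type*} [Field F] [Fintype F] (p q n : ℕ)
    (hp : p.Prime) (hp4 : p % 4 = 3) (hn : n = 2 * p)
    (hq : Fintype.card F = q) (hq4 : q % 4 = 3) (hpq : Nat.Coprime p q)
    (hord : orderOf (q : ZMod (4 * p)) = p - 1)
    (hordp : orderOf (q : ZMod p) % 4 = 2) :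
    (Irreducible (X ^ 2 + 1 : F[X]) ∧
      ∃ g₁ g₂ : F[X], g₁.Monic ∧ g₂.Monic ∧ Irreducible g₁ ∧ Irreducible g₂ ∧
        g₁.natDegree = p - 1 ∧ g₂.natDegree = p - 1 ∧
        g₁.reverse = g₁ ∧ g₂.reverse = g₂ ∧
        (X ^ n + 1 : F[X]) = (X ^ 2 + 1) * g₁ * g₂) ∧
    {C : Submodule F (Fin 2 × Fin n → F) | IsSelfDual C ∧
      ∃ h : Fin n → F, C = doubleNegacirculantCode h ∧
        IsGeneratedBy C {![1, toNegaRing h]}}.ncard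
      = (q + 1) * (q ^ ((p - 1) / 2) + 1) ^ 2 ∧
    {C : Submodule F (Fin 4 × Fin n → F) | IsSelfDual C ∧
      ∃ a b : Fin n → F, C = fourNegacirculantCode a b ∧
        IsGeneratedBy C {![1, 0, toNegaRing a, toNegaRing b],
          ![0, 1, -toNegaRingPrime b, toNegaRingPrime a]}}.ncard
      = (q + 1) * (q ^ 2 - q) * (q ^ ((p - 1) / 2) + 1) ^ 2 *
        (q ^ (p - 1) - q ^ ((p - 1) / 2)) ^ 2 := by
  subst hq hn
  set q := Fintype.card F
  have : NeZero (2 * p) := ⟨by have := hp.pos; omega⟩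
  have hcop2 : Nat.Coprime 2 q := by rw [Nat.coprime_two_left, Nat.odd_iff]; omega
  have hcop : (4 * p).Coprime q := Nat.Coprime.mul_left (hcop2.pow_left 2 :) hpq
  have hi₀ : Irreducible (X ^ 2 + 1 : F[X]) := irreducible_X_sq_add_one hq4
  obtain ⟨g₁, g₂, hm₁, hm₂, hi₁, hi₂, hd₁, hd₂, hg⟩ :=
    exists_irreducible_factors_cyclotomic hp (by omega) hcop hord
  have hf : (X ^ (2 * p) + 1 : F[X]) = (X ^ 2 + 1) * g₁ * g₂ := by
    rw [X_pow_two_mul_prime_add_one_eq F hp (by omega), hg, mul_assoc]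
  have dvd₀ : (X ^ 2 + 1 : F[X]) ∣ X ^ (2 * p) + 1 := ⟨g₁ * g₂, by rw [hf, mul_assoc]⟩
  have dvd₁ : g₁ ∣ X ^ (2 * p) + 1 := ⟨(X ^ 2 + 1) * g₂, by rw [hf]; ring⟩
  have dvd₂ : g₂ ∣ X ^ (2 * p) + 1 := ⟨(X ^ 2 + 1) * g₁, by rw [hf]; ring⟩
  have hQ := four_mul_prime_dvd_pow_add_one hp hp4 hq4 hordp
  have hQ' : 2 * (2 * p) ∣ q ^ ((p - 1) / 2) + 1 := by convert hQ using 1; ring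
  -- Here `x² + 1` is its own case `n = 2`, and `4 ∣ q + 1`. The exponent is kept as `q ^ 1` to
  -- match the shape `q ^ k` used on the other components.
  have hz₀ : AdjoinRoot.root (X ^ 2 + 1 : F[X]) * AdjoinRoot.root (X ^ 2 + 1 : F[X]) ^ q ^ 1 = 1 :=
    root_mul_pow_eq_one dvd_rfl (by rw [pow_one]; omega)
  have hz₁ := root_mul_pow_eq_one dvd₁ hQ'
  have hz₂ := root_mul_pow_eq_one dvd₂ hQ'
  refine ⟨⟨hi₀, g₁, g₂, hm₁, hm₂, hi₁, hi₂, hd₁, hd₂,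
    reverse_eq_self_of_root_mul_pow_eq_one hi₁ hm₁ (by omega) hz₁,
    reverse_eq_self_of_root_mul_pow_eq_one hi₂ hm₂ (by omega) hz₂, hf⟩, ?_⟩
  -- Since `2p` is invertible in `F`, the polynomial is separable, which makes the three factors
  -- coprime.
  have hsep : (X ^ (2 * p) + 1 : F[X]).Separable := by
    have := separable_X_pow_sub_C (-1 : F) (n := 2 * p)
      (natCast_ne_zero_of_coprime_card (hcop2.mul_left hpq)) (by simp)
    simpa using this
  rw [hf] at hsep
  have hbij := adjoinRoot_prod_bijective (monic_X_pow_add_one F (2 * p)).ne_zero hf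
    hsep.of_mul_left.isCoprime hsep.isCoprime dvd₀ dvd₁ dvd₂
  have c₀ := algHomOfDvd_conj dvd₀ hz₀
  have c₁ := algHomOfDvd_conj dvd₁ hz₁
  have c₂ := algHomOfDvd_conj dvd₂ hz₂
  have := Fact.mk hi₀
  have := Fact.mk hi₁
  have := Fact.mk hi₂
  have hexp : (p - 1) / 2 * 2 = p - 1 := Nat.div_mul_cancel (by omega)
  have card₀ : Nat.card (AdjoinRoot (X ^ 2 + 1 : F[X])) = (q ^ 1) ^ 2 := by
    rw [natCard_adjoinRoot hi₀.ne_zero, pow_one]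
    congr 1
    simpa using natDegree_X_pow_add_C (n := 2) (r := (1 : F))
  have card₁ : Nat.card (AdjoinRoot g₁) = (q ^ ((p - 1) / 2)) ^ 2 := by
    rw [natCard_adjoinRoot hi₁.ne_zero, hd₁, ← pow_mul, hexp]
  have card₂ : Nat.card (AdjoinRoot g₂) = (q ^ ((p - 1) / 2)) ^ 2 := by
    rw [natCard_adjoinRoot hi₂.ne_zero, hd₂, ← pow_mul, hexp]
  have norms {P : F[X]} [Fact (Irreducible P)] {k : ℕ}
      (hK : Nat.card (AdjoinRoot P) = (q ^ k) ^ 2) :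
      Nat.card {y : AdjoinRoot P // y * y ^ q ^ k = -1} = q ^ k + 1 ∧
      Nat.card {y : AdjoinRoot P × AdjoinRoot P //
        y.1 * y.1 ^ q ^ k + y.2 * y.2 ^ q ^ k = -1} =
          (q ^ k + 1) * ((q ^ k) ^ 2 - q ^ k) := by
    have : Finite (AdjoinRoot P) := Nat.finite_of_card_ne_zero
      (by rw [hK]; have : q ≠ 0 := by omega
          positivity)
    obtain ⟨φ, hφ⟩ := exists_algHom_eq_pow_card_pow (F := F) (AdjoinRoot P) k
    have h1 : (-1 : AdjoinRoot P) ^ q ^ k = -1 := by rw [← hφ, map_neg, map_one]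
    exact ⟨card_norm_eq hK (by simp) h1,
      card_sum_two_norms_eq hK (φ : AdjoinRoot P →+* AdjoinRoot P) hφ (by simp) h1⟩
  constructor
  · rw [ncard_selfDual_doubleNegacirculantCode]
    refine (card_norm_eq_neg_one_prod hbij c₀ c₁ c₂).trans ?_
    rw [(norms card₀).1, (norms card₁).1, (norms card₂).1]
    ring
  · rw [ncard_selfDual_fourNegacirculantCode]
    refine (card_sum_two_norms_eq_neg_one_prod hbij c₀ c₁ c₂).trans ?_
    rw [(norms card₀).2, (norms card₁).2, (norms card₂).2, ← pow_mul q ((p - 1) / 2) 2,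
      hexp, pow_one]
    ring
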